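/- All systems are finite-dimensional. Let $|\phi\rangle\in A\otimes B$ (the seed state) and $|\psi\rangle\in A'\otimes B'$ (the target state) be unit vectors, with density matrices $\phi=|\phi\rangle\langle\phi|$ and $\psi=|\psi\rangle\langle\psi|$, and let $F(R,S)=\bigl(\operatorname{Tr}\sqrt{\sqrt S R\sqrt S}\bigr)^2$ be the fidelity. Put $$F_{\mathrm{LO}}(\psi,\phi)=\sup_{\mathcal E,\mathcal F}F\bigl(\psi,(\mathcal E\otimes\mathcal F)(\phi)\bigr),\qquad F_{\mathrm{LOSR}}(\psi,\phi)=\sup_{\mu,(\mathcal E_\lambda),(\mathcal F_\lambda)}F\Bigl(\psi,\int(\mathcal E_\lambda\otimes\mathcal F_\lambda)(\phi)\,d\mu(\lambda)\Bigr),$$ where $\mathcal E,\mathcal E_\lambda$ range over the quantum channels (completely positive trace-preserving maps) from $A$ to $A'$, $\mathcal F,\mathcal F_\lambda$ over those from $B$ to $B'$, and $\mu$ over probability measures on a space of values $\lambda$ of the shared randomness, the families being measurable in $\lambda$. Theorem. Unless the seed state $|\phi\rangle$ is, up to local unitaries, of the form $|\psi\rangle\otimes|\zeta\rangle$ for some bipartite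 pure state $|\zeta\rangle\in E_1\otimes E_2$ (where $E_1$ belongs to the first party and $E_2$ to the second), one has $F_{\mathrm{LO}}(\psi,\phi)<1$ and $F_{\mathrm{LOSR}}(\psi,\phi)<1$. Hence there is an $\varepsilon>0$ such that every local protocol without communication (local channels $\mathcal E\otimes\mathcal F$, with or without shared randomness) takes $\phi$ to a state whose fidelity with $\psi$ is less than $1-\varepsilon$. Here "up to local unitaries" is understood after embedding the local spaces isometrically into common ones: there are finite-dimensional spaces $C,D$ and isometries $V:A\to C$, $W:B\to D$, $V':A'\otimes E_1\to C$, $W':B'\otimes E_2\to D$ with $(V\otimes W)|\phi\rangle=(V'\otimes W')(|\psi\rangle\otimes|\zeta\rangle)$. -/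

import Mathlib

open scoped Kronecker ComplexOrder MatrixOrder

noncomputable section

namespace ZeroComm

variable {a b a' b' : Type*} [Fintype a] [Fintype b] [Fintype a'] [Fintype b']
  [DecidableEq a] [DecidableEq b] [DecidableEq a'] [DecidableEq b']

/-- The density matrix `|ψ⟩⟨ψ|`. -/
def pureState {n : Type*} (ψ : EuclideanSpace ℂ n) : Matrix n n ℂ :=
  Matrix.vecMulVec (fun i => ψ i) (fun i => star (ψ i))

/-- The (squared) fidelity `F(R, S) = (Tr √(√S R √S))²` of positive semidefinite matrices. -/
def fidelity {n : Type*} [Fintype n] [DecidableEq n] (R S : Matrix n n ℂ) : ℝ :=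
  (Matrix.trace (CFC.sqrt (CFC.sqrt S * R * CFC.sqrt S))).re ^ 2

/-- The value at `X` of the tensor product `E ⊗ F` of two linear maps on matrices: the linear
extension of `(E ⊗ F)(Y ⊗ Z) = E(Y) ⊗ F(Z)`, expanded in matrix units. -/
def tensorApply (E : Matrix a a ℂ →ₗ[ℂ] Matrix a' a' ℂ) (F : Matrix b b ℂ →ₗ[ℂ] Matrix b' b' ℂ)
    (X : Matrix (a × b) (a × b) ℂ) : Matrix (a' × b') (a' × b') ℂ :=
  ∑ p, ∑ q, ∑ r, ∑ s,
    X (p, r) (q, s) • (E (Matrix.single p q 1) ⊗ₖ F (Matrix.single r s 1))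

/-- Quantum channels: completely positive trace-preserving linear maps. -/
structure IsChannel (E : Matrix a a ℂ →ₗ[ℂ] Matrix a' a' ℂ) : Prop where
  completelyPositive : ∀ (k : ℕ) (X : Matrix (Fin k × a) (Fin k × a) ℂ), X.PosSemidef →
    (tensorApply (LinearMap.id : Matrix (Fin k) (Fin k) ℂ →ₗ[ℂ] _) E X).PosSemidef
  tracePreserving : ∀ X : Matrix a a ℂ, (E X).trace = X.trace

/-- The optimal fidelity of converting the seed `σ` on `A ⊗ B` into the target `ρ` on `A' ⊗ B'`
by local operations. -/
def loFidelity (ρ : Matrix (a' × b') (a' × b') ℂ) (σ : Matrix (a × b) (a × b) ℂ) : ℝ :=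
  sSup {x : ℝ | ∃ (E : Matrix a a ℂ →ₗ[ℂ] Matrix a' a' ℂ) (F : Matrix b b ℂ →ₗ[ℂ] Matrix b' b' ℂ),
    IsChannel E ∧ IsChannel F ∧ x = fidelity ρ (tensorApply E F σ)}

variable (a b a' b') in
/-- A protocol of local operations and shared randomness from `A ⊗ B` to `A' ⊗ B'`: a probability
space of values `l` of the shared randomness, and measurable families of local channels. -/
structure LOSRProtocol where
  Randomness : Type
  [measurableSpace : MeasurableSpace Randomness]
  μ : MeasureTheory.Measure Randomness
  isProbabilityMeasure : MeasureTheory.IsProbabilityMeasure μ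
  E : Randomness → (Matrix a a ℂ →ₗ[ℂ] Matrix a' a' ℂ)
  F : Randomness → (Matrix b b ℂ →ₗ[ℂ] Matrix b' b' ℂ)
  isChannel_E : ∀ l, IsChannel (E l)
  isChannel_F : ∀ l, IsChannel (F l)
  measurable_E : ∀ X i j, Measurable fun l => E l X i j
  measurable_F : ∀ X i j, Measurable fun l => F l X i j

attribute [instance] LOSRProtocol.measurableSpace

/-- The output `∫ (E_l ⊗ F_l)(σ) dμ(l)` of a protocol, the integral being taken entrywise. -/
def LOSRProtocol.output (P : LOSRProtocol a b a' b') (σ : Matrix (a × b) (a × b) ℂ) :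
    Matrix (a' × b') (a' × b') ℂ :=
  Matrix.of fun x y => ∫ l, tensorApply (P.E l) (P.F l) σ x y ∂P.μ

/-- The optimal fidelity of converting the seed `σ` on `A ⊗ B` into the target `ρ` on `A' ⊗ B'`
by local operations and shared randomness. -/
def losrFidelity (ρ : Matrix (a' × b') (a' × b') ℂ) (σ : Matrix (a × b) (a × b) ℂ) : ℝ :=
  sSup {x : ℝ | ∃ P : LOSRProtocol a b a' b', x = fidelity ρ (P.output σ)}

/-- The bipartite vector `ψ ⊗ ζ`, with first party `A ⊗ A'` and second party `B ⊗ B'`. -/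
def tensorState (ψ : EuclideanSpace ℂ (a × b)) (ζ : EuclideanSpace ℂ (a' × b')) :
    EuclideanSpace ℂ ((a × a') × (b × b')) :=
  WithLp.toLp 2 fun x => ψ (x.1.1, x.2.1) * ζ (x.1.2, x.2.2)

/-- Equality of bipartite vectors up to local unitaries. As the local spaces of `φ` and `χ` may
differ, they are embedded into common local spaces `ℂᵐ` and `ℂⁿ`; a local unitary that follows an
embedding makes it an arbitrary local isometry. -/
def LocallyUnitarilyEquivalent (φ : EuclideanSpace ℂ (a × b)) (χ : EuclideanSpace ℂ (a' × b')) :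
    Prop :=
  ∃ (m n : ℕ) (V : Matrix (Fin m) a ℂ) (W : Matrix (Fin n) b ℂ)
    (V' : Matrix (Fin m) a' ℂ) (W' : Matrix (Fin n) b' ℂ),
    V.conjTranspose * V = 1 ∧ W.conjTranspose * W = 1 ∧
    V'.conjTranspose * V' = 1 ∧ W'.conjTranspose * W' = 1 ∧
    Matrix.mulVec (V ⊗ₖ W) (fun i => φ i) = Matrix.mulVec (V' ⊗ₖ W') (fun i => χ i)

end ZeroComm

end

namespace ZeroComm

/-! ### Fidelity with a pure state -/

section Fidelity

/-! Against a pure target the fidelity is the expectation `⟨ψ|S|ψ⟩` (`fidelity_pureState`), which is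
linear in `S`; a bound valid for all local channels therefore survives averaging over shared
randomness.

Every channel dilates to an isometry whose environment `A ⊗ A'` does not depend on the channel
(`IsChannel.exists_isometry`). The fidelity of a local protocol is then `‖ζ‖²`, where `ζ = (⟨ψ| ⊗
1)(V ⊗ W)|φ⟩` is a vector of the environments. This is continuous in `(V, W)`, and the pairs of
isometries form a compact set, so a maximum `c` is attained whenever such pairs exist. Bessel's
identity gives `c ≤ 1`, and `c = 1` would force `(V ⊗ W)|φ⟩ = |ψ⟩ ⊗ |ζ⟩`, the excluded form. Hence
`c < 1`; attainment is what turns strict inequality for each protocol into a uniform gap. -/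

theorem star_dotProduct_self_eq_sum {n : Type*} [Fintype n] (v : n → ℂ) :
    star v ⬝ᵥ v = ((∑ i, ‖v i‖ ^ 2 : ℝ) : ℂ) := by
  simp only [dotProduct, Complex.ofReal_sum, Complex.ofReal_pow, ← Complex.conj_mul']
  rfl

variable {n : Type*} [Fintype n] [DecidableEq n]

/-- The square root of the rank-one matrix `v v*` is `v v* / ‖v‖`, with trace `‖v‖`. For `v = 0` the
convention `0⁻¹ = 0` keeps the formula valid. -/
theorem trace_sqrt_vecMulVec_star_sq (v : n → ℂ) :
    (Matrix.trace (CFC.sqrt (Matrix.vecMulVec v (star v)))).re ^ 2 = ∑ i, ‖v i‖ ^ 2 := by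
  set s : ℝ := ∑ i, ‖v i‖ ^ 2 with hs
  have hs0 : 0 ≤ s := Finset.sum_nonneg fun i _ => sq_nonneg _
  have hdot : star v ⬝ᵥ v = (s : ℂ) := star_dotProduct_self_eq_sum v
  set t : ℝ := √s with ht
  have htt : t * t = s := Real.mul_self_sqrt hs0
  have hpsd : (Matrix.vecMulVec v (star v)).PosSemidef := Matrix.posSemidef_vecMulVec_self_star v
  have hsqrt : CFC.sqrt (Matrix.vecMulVec v (star v)) =
      ((t⁻¹ : ℝ) : ℂ) • Matrix.vecMulVec v (star v) := by
    refine CFC.sqrt_unique ?_ ?_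
    · rw [smul_mul_smul_comm, Matrix.vecMulVec_mul_vecMulVec, hdot, Matrix.vecMulVec_smul,
        smul_smul]
      rcases eq_or_ne t 0 with h0 | h0
      · have : s = 0 := by rw [← htt, h0, mul_zero]
        have hv : v = 0 := by
          rw [this, Complex.ofReal_zero] at hdot
          exact dotProduct_star_self_eq_zero.1 (hdot)
        simp [hv]
      · have h1 : t⁻¹ * t⁻¹ * s = 1 := by rw [← htt]; field_simp
        rw [← Complex.ofReal_mul, ← Complex.ofReal_mul, h1, Complex.ofReal_one, one_smul]
    · rw [Matrix.nonneg_iff_posSemidef]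
      refine hpsd.smul ?_
      rw [Complex.zero_le_real]
      positivity
  rw [hsqrt, Matrix.trace_smul, Matrix.trace_vecMulVec, dotProduct_comm, hdot, smul_eq_mul,
    ← Complex.ofReal_mul, Complex.ofReal_re]
  rcases eq_or_ne t 0 with h0 | h0
  · rw [← htt, h0]; simp
  · rw [← htt]; field_simp

/-- The fidelity of a pure state with `S` is the expectation value of `S`. -/
theorem fidelity_pureState {S : Matrix n n ℂ} (hS : S.PosSemidef) (ψ : EuclideanSpace ℂ n) :
    fidelity (pureState ψ) S = (star (ψ : n → ℂ) ⬝ᵥ S.mulVec ψ).re := by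
  set R := CFC.sqrt S with hR
  have hR0 : R.PosSemidef := Matrix.nonneg_iff_posSemidef.1 (CFC.sqrt_nonneg S)
  have hRR : R * R = S := CFC.sqrt_mul_sqrt_self S (Matrix.nonneg_iff_posSemidef.2 hS)
  have hvec : R * pureState ψ * R =
      Matrix.vecMulVec (R.mulVec ψ) (star (R.mulVec ψ)) := by
    rw [Matrix.star_mulVec, hR0.isHermitian.eq, ← Matrix.vecMulVec_mul, ← Matrix.mul_vecMulVec]
    rfl
  rw [fidelity, ← hR, hvec, trace_sqrt_vecMulVec_star_sq, ← hRR, ← Matrix.mulVec_mulVec,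
    Matrix.dotProduct_mulVec]
  have : Matrix.vecMul (star (ψ : n → ℂ)) R = star (R.mulVec ψ) := by
    rw [Matrix.star_mulVec, hR0.isHermitian.eq]
  rw [this, star_dotProduct_self_eq_sum, Complex.ofReal_re]

end Fidelity

/-! ### Isometries and local dilations of the seed -/

theorem sum_norm_sq_mulVec {m n : Type*} [Fintype m] [Fintype n] [DecidableEq n]
    {U : Matrix m n ℂ} (hU : U.conjTranspose * U = 1) (v : n → ℂ) :
    ∑ i, ‖U.mulVec v i‖ ^ 2 = ∑ j, ‖v j‖ ^ 2 := by
  apply Complex.ofReal_injective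
  rw [← star_dotProduct_self_eq_sum, ← star_dotProduct_self_eq_sum, Matrix.star_mulVec,
    ← Matrix.dotProduct_mulVec, Matrix.mulVec_mulVec, hU, Matrix.one_mulVec]

theorem kronecker_isometry {a b m n : Type*} [Fintype m] [Fintype n]
    [DecidableEq a] [DecidableEq b] {V : Matrix m a ℂ} {W : Matrix n b ℂ}
    (hV : V.conjTranspose * V = 1) (hW : W.conjTranspose * W = 1) :
    (V ⊗ₖ W).conjTranspose * (V ⊗ₖ W) = 1 := by
  rw [Matrix.conjTranspose_kronecker, ← Matrix.mul_kronecker_mul, hV, hW,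
    Matrix.one_kronecker_one]

section Dilation

variable {a b a' b' e f : Type*} [Fintype a] [Fintype b]

/-- The vector `(V ⊗ W)|φ⟩`, as a matrix from the environments to the outputs. -/
def dilatedMatrix (φ : EuclideanSpace ℂ (a × b)) (V : Matrix (a' × e) a ℂ)
    (W : Matrix (b' × f) b ℂ) : Matrix (a' × b') (e × f) ℂ :=
  Matrix.of fun x g => (V ⊗ₖ W).mulVec φ ((x.1, g.1), (x.2, g.2))

variable [Fintype a'] [Fintype b'] in
/-- The conditional state of the environments when the output of the dilation is found in `ψ`. -/
def environmentState (φ : EuclideanSpace ℂ (a × b)) (ψ : EuclideanSpace ℂ (a' × b'))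
    (V : Matrix (a' × e) a ℂ) (W : Matrix (b' × f) b ℂ) : e × f → ℂ :=
  Matrix.vecMul (star (ψ : a' × b' → ℂ)) (dilatedMatrix φ V W)

theorem mulVec_kronecker_apply (φ : EuclideanSpace ℂ (a × b)) (V : Matrix (a' × e) a ℂ)
    (W : Matrix (b' × f) b ℂ) (x : (a' × e) × (b' × f)) :
    (V ⊗ₖ W).mulVec φ x = ∑ p, ∑ r, V x.1 p * W x.2 r * φ (p, r) := by
  simp [Matrix.mulVec, dotProduct, Fintype.sum_prod_type]

variable [Fintype a'] [Fintype b'] [Fintype e] [Fintype f]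

/-- With `M` the dilated matrix, `M M†` is the partial trace over the environments, and `ψ† M M† ψ =
‖ψ† M‖²`. -/
theorem expectation_dilatedMatrix (φ : EuclideanSpace ℂ (a × b)) (ψ : EuclideanSpace ℂ (a' × b'))
    (V : Matrix (a' × e) a ℂ) (W : Matrix (b' × f) b ℂ) :
    (star (ψ : a' × b' → ℂ) ⬝ᵥ
      (dilatedMatrix φ V W * (dilatedMatrix φ V W).conjTranspose).mulVec ψ).re =
      ∑ g, ‖environmentState φ ψ V W g‖ ^ 2 := by
  rw [← Matrix.mulVec_mulVec, Matrix.dotProduct_mulVec]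
  have : (dilatedMatrix φ V W).conjTranspose.mulVec ψ = star (environmentState φ ψ V W) := by
    rw [environmentState, Matrix.star_vecMul, star_star]
  rw [this]
  change (environmentState φ ψ V W ⬝ᵥ star (environmentState φ ψ V W)).re = _
  rw [dotProduct_comm, star_dotProduct_self_eq_sum, Complex.ofReal_re]

theorem continuous_environmentState (φ : EuclideanSpace ℂ (a × b))
    (ψ : EuclideanSpace ℂ (a' × b')) :
    Continuous fun U : Matrix (a' × e) a ℂ × Matrix (b' × f) b ℂ =>
      ∑ g, ‖environmentState φ ψ U.1 U.2 g‖ ^ 2 := by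
  simp only [environmentState, Matrix.vecMul, dotProduct, dilatedMatrix, Matrix.of_apply,
    mulVec_kronecker_apply]
  have h1 : ∀ x p, Continuous fun U : Matrix (a' × e) a ℂ × Matrix (b' × f) b ℂ => U.1 x p :=
    fun x p => continuous_fst.matrix_elem x p
  have h2 : ∀ x p, Continuous fun U : Matrix (a' × e) a ℂ × Matrix (b' × f) b ℂ => U.2 x p :=
    fun x p => continuous_snd.matrix_elem x p
  fun_prop

variable [DecidableEq a] [DecidableEq b]

theorem sum_norm_sq_dilatedMatrix {φ : EuclideanSpace ℂ (a × b)} (hφ : ‖φ‖ = 1)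
    {V : Matrix (a' × e) a ℂ} {W : Matrix (b' × f) b ℂ}
    (hV : V.conjTranspose * V = 1) (hW : W.conjTranspose * W = 1) :
    ∑ x, ∑ g, ‖dilatedMatrix φ V W x g‖ ^ 2 = 1 := by
  have h := sum_norm_sq_mulVec (kronecker_isometry hV hW) φ
  rw [← EuclideanSpace.norm_sq_eq, hφ, one_pow] at h
  rw [← h, ← Fintype.sum_prod_type']
  exact Fintype.sum_equiv (Equiv.prodProdProdComm _ _ _ _) _ _ fun _ => rfl

/-- Bessel's identity for the projection of the dilated state onto `ψ`. -/
theorem sum_norm_sq_sub_environmentState {φ : EuclideanSpace ℂ (a × b)}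
    {ψ : EuclideanSpace ℂ (a' × b')} (hφ : ‖φ‖ = 1) (hψ : ‖ψ‖ = 1)
    {V : Matrix (a' × e) a ℂ} {W : Matrix (b' × f) b ℂ}
    (hV : V.conjTranspose * V = 1) (hW : W.conjTranspose * W = 1) :
    ∑ x, ∑ g, ‖dilatedMatrix φ V W x g - ψ x * environmentState φ ψ V W g‖ ^ 2 =
      1 - ∑ g, ‖environmentState φ ψ V W g‖ ^ 2 := by
  rw [← sum_norm_sq_dilatedMatrix hφ hV hW, Finset.sum_comm,
    Finset.sum_comm (f := fun x g => ‖dilatedMatrix φ V W x g‖ ^ 2), ← Finset.sum_sub_distrib]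
  refine Finset.sum_congr rfl fun g _ => ?_
  have hψ2 : ∑ x, ‖ψ x‖ ^ 2 = 1 := by rw [← EuclideanSpace.norm_sq_eq, hψ, one_pow]
  set ζ := environmentState φ ψ V W g with hζ
  have hζ' : ζ = ∑ x, star (ψ x) * dilatedMatrix φ V W x g := rfl
  -- Summed over `x`, the cross term becomes `-2‖ζ‖²` and the last term `‖ζ‖²`.
  have h1 : ∀ x, ‖dilatedMatrix φ V W x g - ψ x * ζ‖ ^ 2 = ‖dilatedMatrix φ V W x g‖ ^ 2
      - 2 * (star ζ * (star (ψ x) * dilatedMatrix φ V W x g)).re + ‖ψ x‖ ^ 2 * ‖ζ‖ ^ 2 := by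
    intro x
    simp only [← Complex.normSq_eq_norm_sq, Complex.normSq_apply, Complex.sub_re, Complex.sub_im,
      Complex.mul_re, Complex.mul_im, Complex.star_def, Complex.conj_re, Complex.conj_im]
    ring
  simp only [h1, Finset.sum_add_distrib, Finset.sum_sub_distrib, ← Finset.mul_sum,
    ← Complex.re_sum, ← Finset.sum_mul, hψ2, ← hζ']
  have h2 : (star ζ * ζ).re = ‖ζ‖ ^ 2 := by
    have := Complex.conj_mul' ζ
    rw [← Complex.ofReal_pow] at this
    exact congrArg Complex.re this
  rw [h2]
  ring

end Dilation

/-- The defining equation is closed, and the columns are unit vectors, so all entries lie in the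
unit disc. -/
theorem isCompact_isometries (m n : Type*) [Fintype m] [Fintype n] [DecidableEq n] :
    IsCompact {V : Matrix m n ℂ | V.conjTranspose * V = 1} := by
  have hK : IsCompact (Set.univ.pi fun _ : m => Set.univ.pi fun _ : n =>
      Metric.closedBall (0 : ℂ) 1) :=
    isCompact_univ_pi fun _ => isCompact_univ_pi fun _ => isCompact_closedBall _ _
  refine IsCompact.of_isClosed_subset hK ?_ ?_
  · exact isClosed_eq (by fun_prop) continuous_const
  · intro V hV i _ j _
    have h := sum_norm_sq_mulVec hV (Pi.single j 1)
    rw [Matrix.mulVec_single_one, Finset.sum_eq_single j] at h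
    · simp only [Matrix.col_apply, Pi.single_eq_same, norm_one, one_pow] at h
      have h1 : ‖V i j‖ ^ 2 ≤ 1 := h ▸ Finset.single_le_sum
        (f := fun i => ‖V i j‖ ^ 2) (fun _ _ => sq_nonneg _) (Finset.mem_univ i)
      rw [mem_closedBall_zero_iff]
      exact (sq_le_one_iff₀ (norm_nonneg _)).1 h1
    · intro k _ hk
      simp [hk]
    · simp

/-! ### Stinespring dilation of channels -/

section Channel

variable {a b a' b' : Type*} [Fintype a] [Fintype b] [Fintype a'] [Fintype b']
  [DecidableEq a] [DecidableEq b]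

/-- The Choi matrix is the image of the unnormalised maximally entangled state `w w*` under `id ⊗
E`, with the ancilla a copy of `A` indexed by `Fin`. -/
theorem IsChannel.posSemidef_choi {E : Matrix a a ℂ →ₗ[ℂ] Matrix a' a' ℂ} (hE : IsChannel E) :
    (Matrix.of fun x y : a × a' => E (Matrix.single x.1 y.1 1) x.2 y.2).PosSemidef := by
  let e := Fintype.equivFin a
  let w : Fin (Fintype.card a) × a → ℂ := fun x => if x.1 = e x.2 then 1 else 0
  have h := (hE.completelyPositive _ _ (Matrix.posSemidef_vecMulVec_self_star w)).submatrix
    (fun x : a × a' => (e x.1, x.2))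
  convert h using 1
  ext x y
  simp only [Matrix.of_apply, Matrix.submatrix_apply, tensorApply, Matrix.sum_apply,
    Matrix.smul_apply, Matrix.kroneckerMap_apply, LinearMap.id_apply, Matrix.vecMulVec_apply,
    Pi.star_apply, smul_eq_mul, w]
  rw [Finset.sum_eq_single (e x.1), Finset.sum_eq_single (e y.1), Finset.sum_eq_single x.1,
    Finset.sum_eq_single y.1]
  · simp
  · intro s _ hs
    simp [hs.symm]
  · simp
  · intro r _ hr
    simp [hr.symm]
  · simp
  · intro q _ hq
    simp [hq]
  · simp
  · intro p _ hp
    simp [hp]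
  · simp

variable [DecidableEq a'] in
/-- Stinespring dilation of a channel by an isometry with environment `A ⊗ A'`, on matrix units. -/
theorem IsChannel.exists_isometry {E : Matrix a a ℂ →ₗ[ℂ] Matrix a' a' ℂ} (hE : IsChannel E) :
    ∃ V : Matrix (a' × (a × a')) a ℂ, V.conjTranspose * V = 1 ∧
      ∀ p q i j, E (Matrix.single p q 1) i j = ∑ e, V (i, e) p * star (V (j, e) q) := by
  -- Factoring the Choi matrix as `B† B` yields Kraus operators: the conjugated rows of `B`, indexed
  -- by `a × a'`.
  obtain ⟨B, hB⟩ := CStarAlgebra.nonneg_iff_eq_star_mul_self.1 hE.posSemidef_choi.nonneg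
  have hV : ∀ p q i j, E (Matrix.single p q 1) i j =
      ∑ e, star (B e (p, i)) * star (star (B e (q, j))) := by
    intro p q i j
    have := congrFun (congrFun hB (p, i)) (q, j)
    simpa [Matrix.mul_apply] using this
  refine ⟨Matrix.of fun x r => star (B x.2 (r, x.1)), ?_, hV⟩
  ext p q
  -- The entry `(p, q)` of `V† V` is the trace of the image of the unit at `(q, p)`.
  have h := hE.tracePreserving (Matrix.single q p 1)
  simp only [Matrix.trace, Matrix.diag_apply, hV] at h
  simp only [Matrix.mul_apply, Matrix.conjTranspose_apply, Matrix.of_apply]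
  simp only [Matrix.single_apply] at h
  rw [Matrix.one_apply]
  simp only [mul_comm (star (star _))]
  rw [Fintype.sum_prod_type]
  simp only [Fintype.sum_prod_type]
  simp only [Fintype.sum_prod_type] at h
  rw [h]
  simp [Finset.sum_ite_eq, ite_and]

/-- The output of the product of two channels, in terms of their dilations. -/
theorem tensorApply_pureState {a b a' b' e f : Type*} [Fintype a] [Fintype b] [DecidableEq a]
    [DecidableEq b] [Fintype e] [Fintype f]
    {E : Matrix a a ℂ →ₗ[ℂ] Matrix a' a' ℂ}
    {F : Matrix b b ℂ →ₗ[ℂ] Matrix b' b' ℂ} {V : Matrix (a' × e) a ℂ} {W : Matrix (b' × f) b ℂ}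
    (hV : ∀ p q i j, E (Matrix.single p q 1) i j = ∑ g, V (i, g) p * star (V (j, g) q))
    (hW : ∀ p q i j, F (Matrix.single p q 1) i j = ∑ g, W (i, g) p * star (W (j, g) q))
    (φ : EuclideanSpace ℂ (a × b)) :
    tensorApply E F (pureState φ) =
      dilatedMatrix φ V W * (dilatedMatrix φ V W).conjTranspose := by
  ext x y
  have hL : tensorApply E F (pureState φ) x y = ∑ p, ∑ q, ∑ r, ∑ s, ∑ g, ∑ h,
      V (x.1, g) p * W (x.2, h) r * φ (p, r) *
        star (V (y.1, g) q * W (y.2, h) s * φ (q, s)) := by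
    simp only [tensorApply, Matrix.sum_apply, Matrix.smul_apply, Matrix.kroneckerMap_apply, hV, hW,
      pureState, Matrix.vecMulVec_apply, smul_eq_mul, Finset.sum_mul, Finset.mul_sum]
    refine Finset.sum_congr rfl fun p _ => Finset.sum_congr rfl fun q _ =>
      Finset.sum_congr rfl fun r _ => Finset.sum_congr rfl fun s _ => ?_
    rw [Finset.sum_comm]
    refine Finset.sum_congr rfl fun g _ => Finset.sum_congr rfl fun h _ => ?_
    simp only [star_mul']
    ring
  have hR : (dilatedMatrix φ V W * (dilatedMatrix φ V W).conjTranspose) x y =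
      ∑ g, ∑ h, ∑ p, ∑ r, ∑ q, ∑ s, V (x.1, g) p * W (x.2, h) r * φ (p, r) *
        star (V (y.1, g) q * W (y.2, h) s * φ (q, s)) := by
    simp only [Matrix.mul_apply, Matrix.conjTranspose_apply, dilatedMatrix, Matrix.of_apply,
      mulVec_kronecker_apply, Fintype.sum_prod_type, star_sum, Finset.sum_mul]
    simp only [Finset.mul_sum]
  rw [hL, hR]
  simp only [← Fintype.sum_prod_type']
  let σ : (a × a × b × b × e × f) ≃ (e × f × a × b × a × b) :=
    ⟨fun ⟨p, q, r, s, g, h⟩ => ⟨g, h, p, r, q, s⟩, fun ⟨g, h, p, r, q, s⟩ => ⟨p, q, r, s, g, h⟩,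
      fun _ => rfl, fun _ => rfl⟩
  exact Fintype.sum_equiv σ _ _ fun _ => rfl

end Channel

/-! ### Perfect conversion and the uniform gap -/

section Equality

variable {a b a' b' e f : Type*} [Fintype a] [Fintype b] [Fintype a'] [Fintype b']
  [DecidableEq a] [DecidableEq b] [DecidableEq a'] [DecidableEq b'] [Fintype e] [Fintype f]

theorem conjTranspose_mul_self_submatrix {m n k : Type*} [Fintype m] [Fintype k] [DecidableEq n]
    {V : Matrix m n ℂ} (hV : V.conjTranspose * V = 1) (σ : k ≃ m) :
    (V.submatrix σ id).conjTranspose * V.submatrix σ id = 1 := by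
  rw [Matrix.conjTranspose_submatrix, Matrix.submatrix_mul_equiv, hV, Matrix.submatrix_id_id]

theorem mulVec_one_submatrix_kronecker {m n k l : Type*} [Fintype m] [Fintype n] [DecidableEq m]
    [DecidableEq n] (σ : k → m) (τ : l → n) (v : m × n → ℂ) (x : k × l) :
    ((1 : Matrix m m ℂ).submatrix σ id ⊗ₖ (1 : Matrix n n ℂ).submatrix τ id).mulVec v x =
      v (σ x.1, τ x.2) := by
  simp [Matrix.mulVec, dotProduct, Fintype.sum_prod_type, Matrix.one_apply]

/-- If a dilated output is found in `ψ` with certainty, then it is `ψ ⊗ ζ`. -/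
theorem exists_locallyUnitarilyEquivalent_tensorState {φ : EuclideanSpace ℂ (a × b)}
    {ψ : EuclideanSpace ℂ (a' × b')} (hφ : ‖φ‖ = 1) (hψ : ‖ψ‖ = 1)
    {V : Matrix (a' × e) a ℂ} {W : Matrix (b' × f) b ℂ}
    (hV : V.conjTranspose * V = 1) (hW : W.conjTranspose * W = 1)
    (h : ∑ g, ‖environmentState φ ψ V W g‖ ^ 2 = 1) :
    ∃ (m n : ℕ) (ζ : EuclideanSpace ℂ (Fin m × Fin n)), ‖ζ‖ = 1 ∧
      LocallyUnitarilyEquivalent φ (tensorState ψ ζ) := by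
  -- The defect in Bessel's identity vanishes, hence so does each of its terms.
  have hprod : ∀ x g, dilatedMatrix φ V W x g = ψ x * environmentState φ ψ V W g := by
    have h0 := sum_norm_sq_sub_environmentState hφ hψ hV hW
    rw [h, sub_self, Finset.sum_eq_zero_iff_of_nonneg
      fun _ _ => Finset.sum_nonneg fun _ _ => sq_nonneg _] at h0
    intro x g
    have h1 := h0 x (Finset.mem_univ x)
    rw [Finset.sum_eq_zero_iff_of_nonneg fun _ _ => sq_nonneg _] at h1
    exact sub_eq_zero.1 (norm_eq_zero.1 (pow_eq_zero_iff two_ne_zero |>.1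
      (h1 g (Finset.mem_univ g))))
  let εe := (Fintype.equivFin e).symm
  let εf := (Fintype.equivFin f).symm
  let σ := (Fintype.equivFin (a' × Fin (Fintype.card e))).symm
  let τ := (Fintype.equivFin (b' × Fin (Fintype.card f))).symm
  -- The common local spaces are the outputs with their environments, so `φ` is embedded by the
  -- dilations and `ψ ⊗ ζ` by mere reindexings.
  refine ⟨Fintype.card e, Fintype.card f,
    WithLp.toLp 2 fun g => environmentState φ ψ V W (εe g.1, εf g.2), ?_,
    _, _, V.submatrix (σ.trans ((Equiv.refl a').prodCongr εe)) id,
    W.submatrix (τ.trans ((Equiv.refl b').prodCongr εf)) id,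
    (1 : Matrix _ _ ℂ).submatrix σ id, (1 : Matrix _ _ ℂ).submatrix τ id,
    conjTranspose_mul_self_submatrix hV _, conjTranspose_mul_self_submatrix hW _,
    conjTranspose_mul_self_submatrix (by simp) _, conjTranspose_mul_self_submatrix (by simp) _, ?_⟩
  · rw [← sq_eq_sq₀ (norm_nonneg _) zero_le_one, EuclideanSpace.norm_sq_eq, one_pow, ← h]
    exact Fintype.sum_equiv (εe.prodCongr εf) _ _ fun _ => rfl
  · funext x
    rw [mulVec_one_submatrix_kronecker]
    exact hprod ((σ x.1).1, (τ x.2).1) (εe (σ x.1).2, εf (τ x.2).2)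

/-- By compactness of the set of isometries, the optimal probability is attained. -/
theorem exists_lt_one_forall_environmentState_le {φ : EuclideanSpace ℂ (a × b)}
    {ψ : EuclideanSpace ℂ (a' × b')} (hφ : ‖φ‖ = 1) (hψ : ‖ψ‖ = 1)
    (h : ¬ ∃ (m n : ℕ) (ζ : EuclideanSpace ℂ (Fin m × Fin n)), ‖ζ‖ = 1 ∧
      LocallyUnitarilyEquivalent φ (tensorState ψ ζ)) :
    ∃ c : ℝ, 0 ≤ c ∧ c < 1 ∧ ∀ (V : Matrix (a' × e) a ℂ) (W : Matrix (b' × f) b ℂ),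
      V.conjTranspose * V = 1 → W.conjTranspose * W = 1 →
        ∑ g, ‖environmentState φ ψ V W g‖ ^ 2 ≤ c := by
  have hK := (isCompact_isometries (a' × e) a).prod (isCompact_isometries (b' × f) b)
  rcases Set.eq_empty_or_nonempty ({V : Matrix (a' × e) a ℂ | V.conjTranspose * V = 1} ×ˢ
    {W : Matrix (b' × f) b ℂ | W.conjTranspose * W = 1}) with h0 | hne
  · refine ⟨0, le_rfl, zero_lt_one, fun V W hV hW => ?_⟩
    exact (Set.eq_empty_iff_forall_notMem.1 h0 (V, W) ⟨hV, hW⟩).elim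
  · obtain ⟨⟨V₀, W₀⟩, ⟨hV₀, hW₀⟩, hmax⟩ := hK.exists_isMaxOn hne
      (continuous_environmentState φ ψ).continuousOn
    refine ⟨∑ g, ‖environmentState φ ψ V₀ W₀ g‖ ^ 2, Finset.sum_nonneg fun _ _ => sq_nonneg _,
      lt_of_le_of_ne ?_ fun h1 =>
        h (exists_locallyUnitarilyEquivalent_tensorState hφ hψ hV₀ hW₀ h1),
      fun V W hV hW => hmax (a := (V, W)) ⟨hV, hW⟩⟩
    rw [← sub_nonneg, ← sum_norm_sq_sub_environmentState hφ hψ hV₀ hW₀]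
    exact Finset.sum_nonneg fun _ _ => Finset.sum_nonneg fun _ _ => sq_nonneg _

end Equality

/-! ### Averaging over shared randomness -/

section Integral

variable {Ω n : Type*} [MeasurableSpace Ω] {μ : MeasureTheory.Measure Ω} [Fintype n]
  {S : Ω → Matrix n n ℂ}

theorem expectation_integral (hS : ∀ x y, MeasureTheory.Integrable (fun l => S l x y) μ)
    (v : n → ℂ) :
    star v ⬝ᵥ (Matrix.of fun x y => ∫ l, S l x y ∂μ).mulVec v =
      ∫ l, star v ⬝ᵥ (S l).mulVec v ∂μ := by
  simp only [dotProduct, Matrix.mulVec, Matrix.of_apply]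
  rw [MeasureTheory.integral_finsetSum]
  · refine Finset.sum_congr rfl fun x _ => ?_
    rw [MeasureTheory.integral_const_mul, MeasureTheory.integral_finsetSum]
    · simp only [MeasureTheory.integral_mul_const]
    · exact fun y _ => (hS x y).mul_const _
  · exact fun x _ => (MeasureTheory.integrable_finsetSum _
      fun y _ => (hS x y).mul_const _).const_mul _

theorem posSemidef_integral (hS : ∀ x y, MeasureTheory.Integrable (fun l => S l x y) μ)
    (h : ∀ l, (S l).PosSemidef) :
    (Matrix.of fun x y => ∫ l, S l x y ∂μ).PosSemidef := by
  refine Matrix.PosSemidef.of_dotProduct_mulVec_nonneg ?_ fun v => ?_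
  · ext x y
    simp only [Matrix.conjTranspose_apply, Matrix.of_apply]
    refine integral_conj.symm.trans ?_
    exact MeasureTheory.integral_congr_ae (.of_forall fun l => (h l).isHermitian.apply x y)
  · rw [expectation_integral hS]
    exact MeasureTheory.integral_nonneg fun l => (h l).dotProduct_mulVec_nonneg v

end Integral

/-- Termwise AM-GM bounds an entry by the mean of two squared row norms. This uniform bound on
outputs makes them integrable in the randomness. -/
theorem norm_mul_conjTranspose_apply_le {m n : Type*} [Fintype m] [Fintype n] (M : Matrix m n ℂ)
    (x y : m) : ‖(M * M.conjTranspose) x y‖ ≤ ∑ x, ∑ g, ‖M x g‖ ^ 2 := by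
  have hle : ∀ z, ∑ g, ‖M z g‖ ^ 2 ≤ ∑ x, ∑ g, ‖M x g‖ ^ 2 := fun z =>
    Finset.single_le_sum (f := fun x => ∑ g, ‖M x g‖ ^ 2)
      (fun _ _ => Finset.sum_nonneg fun _ _ => sq_nonneg _) (Finset.mem_univ z)
  calc ‖(M * M.conjTranspose) x y‖ ≤ ∑ g, ‖M x g‖ * ‖M y g‖ := by
        rw [Matrix.mul_apply]
        refine (norm_sum_le _ _).trans (le_of_eq (Finset.sum_congr rfl fun g _ => ?_))
        rw [norm_mul, Matrix.conjTranspose_apply, norm_star]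
    _ ≤ ∑ g, (‖M x g‖ ^ 2 + ‖M y g‖ ^ 2) / 2 :=
        Finset.sum_le_sum fun g _ => by linarith [two_mul_le_add_sq ‖M x g‖ ‖M y g‖]
    _ ≤ _ := by
        rw [← Finset.sum_div, Finset.sum_add_distrib]
        linarith [hle x, hle y]

/-! ### Positivity and integrability of protocol outputs -/

section Output

variable {a b a' b' : Type*} [Fintype a] [Fintype b] [Fintype a'] [Fintype b']
  [DecidableEq a] [DecidableEq b] [DecidableEq a'] [DecidableEq b']
  {E : Matrix a a ℂ →ₗ[ℂ] Matrix a' a' ℂ} {F : Matrix b b ℂ →ₗ[ℂ] Matrix b' b' ℂ}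

theorem posSemidef_tensorApply_pureState (hE : IsChannel E) (hF : IsChannel F)
    (φ : EuclideanSpace ℂ (a × b)) : (tensorApply E F (pureState φ)).PosSemidef := by
  obtain ⟨V, -, hV⟩ := hE.exists_isometry
  obtain ⟨W, -, hW⟩ := hF.exists_isometry
  rw [tensorApply_pureState hV hW]
  exact Matrix.posSemidef_self_mul_conjTranspose _

theorem norm_tensorApply_pureState_le (hE : IsChannel E) (hF : IsChannel F)
    {φ : EuclideanSpace ℂ (a × b)} (hφ : ‖φ‖ = 1) (x y : a' × b') :
    ‖tensorApply E F (pureState φ) x y‖ ≤ 1 := by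
  obtain ⟨V, hV1, hV⟩ := hE.exists_isometry
  obtain ⟨W, hW1, hW⟩ := hF.exists_isometry
  rw [tensorApply_pureState hV hW, ← sum_norm_sq_dilatedMatrix hφ hV1 hW1]
  exact norm_mul_conjTranspose_apply_le _ x y

theorem LOSRProtocol.integrable_tensorApply (P : LOSRProtocol a b a' b')
    {φ : EuclideanSpace ℂ (a × b)} (hφ : ‖φ‖ = 1) (x y : a' × b') :
    MeasureTheory.Integrable (fun l => tensorApply (P.E l) (P.F l) (pureState φ) x y) P.μ := by
  have := P.isProbabilityMeasure
  refine MeasureTheory.Integrable.of_bound (C := 1) ?_ (.of_forall fun l =>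
    norm_tensorApply_pureState_le (P.isChannel_E l) (P.isChannel_F l) hφ x y)
  refine Measurable.aestronglyMeasurable ?_
  simp only [tensorApply, Matrix.sum_apply, Matrix.smul_apply, Matrix.kroneckerMap_apply]
  refine Finset.measurable_fun_sum _ fun p _ => Finset.measurable_fun_sum _ fun q _ =>
    Finset.measurable_fun_sum _ fun r _ => Finset.measurable_fun_sum _ fun s _ => ?_
  exact ((P.measurable_E (Matrix.single p q 1) x.1 y.1).mul
    (P.measurable_F (Matrix.single r s 1) x.2 y.2)).const_mul (pureState φ (p, r) (q, s))

end Output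

end ZeroComm

theorem mainTheorem7 {a b a' b' : Type*} [Fintype a] [Fintype b] [Fintype a'] [Fintype b']
    [DecidableEq a] [DecidableEq b] [DecidableEq a'] [DecidableEq b']
    (φ : EuclideanSpace ℂ (a × b)) (ψ : EuclideanSpace ℂ (a' × b'))
    (hφ : ‖φ‖ = 1) (hψ : ‖ψ‖ = 1)
    (h : ¬ ∃ (m n : ℕ) (ζ : EuclideanSpace ℂ (Fin m × Fin n)), ‖ζ‖ = 1 ∧
      ZeroComm.LocallyUnitarilyEquivalent φ (ZeroComm.tensorState ψ ζ)) :
    ZeroComm.loFidelity (ZeroComm.pureState ψ) (ZeroComm.pureState φ) < 1 ∧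
    ZeroComm.losrFidelity (ZeroComm.pureState ψ) (ZeroComm.pureState φ) < 1 ∧
    ∃ ε : ℝ, 0 < ε ∧
      (∀ (E : Matrix a a ℂ →ₗ[ℂ] Matrix a' a' ℂ) (F : Matrix b b ℂ →ₗ[ℂ] Matrix b' b' ℂ),
        ZeroComm.IsChannel E → ZeroComm.IsChannel F →
        ZeroComm.fidelity (ZeroComm.pureState ψ)
          (ZeroComm.tensorApply E F (ZeroComm.pureState φ)) < 1 - ε) ∧
      (∀ P : ZeroComm.LOSRProtocol a b a' b',
        ZeroComm.fidelity (ZeroComm.pureState ψ) (P.output (ZeroComm.pureState φ)) < 1 - ε) := by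

  obtain ⟨c, hc0, hc1, hc⟩ := ZeroComm.exists_lt_one_forall_environmentState_le
    (e := a × a') (f := b × b') hφ hψ h
  have hexp : ∀ (E : Matrix a a ℂ →ₗ[ℂ] Matrix a' a' ℂ) (F : Matrix b b ℂ →ₗ[ℂ] Matrix b' b' ℂ),
      ZeroComm.IsChannel E → ZeroComm.IsChannel F → (star (ψ : a' × b' → ℂ) ⬝ᵥ
        (ZeroComm.tensorApply E F (ZeroComm.pureState φ)).mulVec ψ).re ≤ c := by
    intro E F hE hF
    obtain ⟨V, hV1, hV⟩ := hE.exists_isometry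
    obtain ⟨W, hW1, hW⟩ := hF.exists_isometry
    rw [ZeroComm.tensorApply_pureState hV hW, ZeroComm.expectation_dilatedMatrix]
    exact hc V W hV1 hW1
  have hLO : ∀ (E : Matrix a a ℂ →ₗ[ℂ] Matrix a' a' ℂ) (F : Matrix b b ℂ →ₗ[ℂ] Matrix b' b' ℂ),
      ZeroComm.IsChannel E → ZeroComm.IsChannel F → ZeroComm.fidelity (ZeroComm.pureState ψ)
        (ZeroComm.tensorApply E F (ZeroComm.pureState φ)) ≤ c := by
    intro E F hE hF
    rw [ZeroComm.fidelity_pureState (ZeroComm.posSemidef_tensorApply_pureState hE hF φ)]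
    exact hexp E F hE hF
  have hLOSR : ∀ P : ZeroComm.LOSRProtocol a b a' b',
      ZeroComm.fidelity (ZeroComm.pureState ψ) (P.output (ZeroComm.pureState φ)) ≤ c := by
    intro P
    have := P.isProbabilityMeasure
    have hint := P.integrable_tensorApply (a' := a') (b' := b') hφ
    have hint' : MeasureTheory.Integrable (fun l => star (ψ : a' × b' → ℂ) ⬝ᵥ
        (ZeroComm.tensorApply (P.E l) (P.F l) (ZeroComm.pureState φ)).mulVec ψ) P.μ :=
      MeasureTheory.integrable_finsetSum _ fun x _ => (MeasureTheory.integrable_finsetSum _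
        fun y _ => (hint x y).mul_const _).const_mul _
    rw [ZeroComm.LOSRProtocol.output, ZeroComm.fidelity_pureState
      (ZeroComm.posSemidef_integral hint fun l =>
        ZeroComm.posSemidef_tensorApply_pureState (P.isChannel_E l) (P.isChannel_F l) φ),
      ZeroComm.expectation_integral hint]
    -- The expectation is at most `c` for each value of the randomness, and `μ` has mass one.
    refine (integral_re hint').symm.trans_le ?_
    refine (MeasureTheory.integral_mono hint'.re (MeasureTheory.integrable_const c)
      fun l => hexp _ _ (P.isChannel_E l) (P.isChannel_F l)).trans ?_
    simp
  -- `0 ≤ c` covers the default value `sSup ∅ = 0`. Half the gap `1 - c` leaves the final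
  -- inequalities strict.
  refine ⟨(Real.sSup_le ?_ hc0).trans_lt hc1, (Real.sSup_le ?_ hc0).trans_lt hc1,
    (1 - c) / 2, by linarith, fun E F hE hF => ?_, fun P => ?_⟩
  · rintro _ ⟨E, F, hE, hF, rfl⟩
    exact hLO E F hE hF
  · rintro _ ⟨P, rfl⟩
    exact hLOSR P
  · linarith [hLO E F hE hF]
  · linarith [hLOSR P]
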